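/- **Model.** Let $1\le b\le\tau$ and $0\le\tau_L\le\tau-b$ be integers, let $w>\tau$, and let $\mathbb F$ be a finite field. A *message size sequence* (with horizon $t\ge\tau$ and maximum size $m$) is a sequence $k_0,\dots,k_t$ of integers in $\{0,\dots,m\}$ whose last $\tau$ terms are $0$. In time slot $i\in\{0,\dots,t\}$ a sender receives a message packet $S[i]\in\mathbb F^{k_i}$ and sends a channel packet $X[i]\in\mathbb F^{n_i}$ that is a function of $S[0],\dots,S[i]$. The channel $C(b,w)$ may lose packets in such a way that within every window of $w$ consecutive time slots the lost packets form a single burst of at most $b$ consecutive packets. A scheme must satisfy * the worst-case-delay constraint: for every loss pattern of $C(b,w)$, each $S[i]$ is determined by the channel packets received by time slot $i+\tau$; * the lossless-delay constraint: if nothing is lost, each $S[i]$ is determined by $X[0],\dots,X[i+\tau_L]$ (packets up to time slot $t$ only). The rate of a scheme on $k$ is $R_t=\sum_{i=0}^t k_i\big/\sum_{i=0}^t n_i$. An *offline* scheme for $k$ may depend on the whole sequence $k_0,\dots,k_t$; the *offline-optimal rate* $R^{\mathrm{off}}(k)$ is the supremum of the rates on $k$ of all offline schemes that satisfy both constraints.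 An *online* scheme is a single scheme for all message size sequences (with the given $t,m$), satisfying both constraints on each of them, in which $n_i$ and the encoding function of $X[i]$ depend only on $k_0,\dots,k_i$. **Theorem.** Suppose that $(\tau,b,\tau_L)$ lies outside Regime 1 ($\tau_L=\tau-b$ and $b\mid\tau$) and outside Regime 2 ($\tau_L=0$). Then the online-optimal rate is strictly less than the offline-optimal rate, in the following sense. There are two sequences of nonnegative integers $k^{(1)},k^{(2)}$, integers $t_0,m_0$ and a number $\varepsilon>0$, all depending only on $(\tau,b,\tau_L)$, such that for all $t\ge t_0$ and $m\ge m_0$ both $k^{(1)}$ and $k^{(2)}$ are (after extension by zeros) message size sequences with horizon $t$ and maximum size $m$, and for every $w>\tau$, every finite field $\mathbb F$ and every online scheme, the rate of the scheme is at most $R^{\mathrm{off}}(k^{(j)})-\varepsilon$ on $k^{(j)}$ for at least one $j\in\{1,2\}$. -/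

import Mathlib

universe u

noncomputable section

namespace Streaming

/-- `k` is a message size sequence `k 0, …, k t`: every size is at most `m`, and the final `τ`
sizes (as well as the padding after time slot `t`) are zero. -/
def IsSizeSeq (τ m t : ℕ) (k : ℕ → ℕ) : Prop :=
  τ ≤ t ∧ (∀ i, k i ≤ m) ∧ ∀ i, t < i + τ → k i = 0

/-- The message packets `S[0], …, S[i]`, where `S[j]` consists of `k j` symbols of `F`. -/
abbrev Prefix (F : Type u) (k : ℕ → ℕ) (i : ℕ) : Type u :=
  (j : Fin (i + 1)) → Fin (k j) → F

/-- All message packets; those after the last time slot are empty. -/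
abbrev Messages (F : Type u) (k : ℕ → ℕ) : Type u :=
  (j : ℕ) → Fin (k j) → F

/-- An (offline) encoder for the size sequence `k`, which it knows completely: in time slot `i`
it sends a channel packet of `n i` symbols that is a function of the message packets
`S[0], …, S[i]`. Only the time slots `0, …, t` are used. -/
structure Code (F : Type u) (k : ℕ → ℕ) where
  n : (i : ℕ) → ℕ
  enc : (i : ℕ) → Prefix F k i → Fin (n i) → F

/-- An online encoder: in time slot `i` the number of symbols sent depends only on the sizes
`κ` of the message packets `0, …, i`, and the symbols sent depend only on these sizes and on the
message packets themselves. -/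
structure OnlineCode (F : Type u) where
  n : (i : ℕ) → (κ : Fin (i + 1) → ℕ) → ℕ
  enc : (i : ℕ) → (κ : Fin (i + 1) → ℕ) →
    ((j : Fin (i + 1)) → Fin (κ j) → F) → Fin (n i κ) → F

/-- The loss patterns of the channel `C(b, w)`: within every window of `w` consecutive time slots
the set `E` of lost packets is a single burst of at most `b` consecutive packets. -/
def IsBurstLoss (b w : ℕ) (E : Set ℕ) : Prop :=
  ∀ i, ∃ s l, l ≤ b ∧ ∀ j, i ≤ j → j < i + w → (j ∈ E ↔ s ≤ j ∧ j < s + l)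

namespace Code

variable {F : Type u} {k : ℕ → ℕ}

/-- The channel packet sent in time slot `i`. -/
def packet (C : Code F k) (S : Messages F k) (i : ℕ) : Fin (C.n i) → F :=
  C.enc i (fun j => S j)

open Classical in
/-- What the receiver has seen by time slot `T` when the packets in `E` are lost; `none` stands
for a packet that was lost or not (yet) sent. -/
def received (C : Code F k) (t : ℕ) (E : Set ℕ) (T : ℕ) (S : Messages F k) :
    (j : ℕ) → Option (Fin (C.n j) → F) :=
  fun j => if j ≤ t ∧ j ≤ T ∧ j ∉ E then some (C.packet S j) else none

/-- Under the loss pattern `E`, the message packet `S[i]` can be decoded by time slot `T`. -/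
def Decodes (C : Code F k) (t : ℕ) (E : Set ℕ) (i T : ℕ) : Prop :=
  ∃ D : ((j : ℕ) → Option (Fin (C.n j) → F)) → (Fin (k i) → F),
    ∀ S : Messages F k, D (C.received t E T S) = S i

/-- The worst-case-delay constraint over the channel `C(b, w)` together with the
lossless-delay constraint. -/
def Feasible (C : Code F k) (τ b τL w t : ℕ) : Prop :=
  (∀ E, IsBurstLoss b w E → ∀ i ≤ t, C.Decodes t E i (i + τ)) ∧
    ∀ i ≤ t, C.Decodes t ∅ i (i + τL)

/-- The number of message symbols divided by the number of transmitted symbols. -/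
def rate (C : Code F k) (t : ℕ) : ℝ :=
  (∑ i ∈ Finset.range (t + 1), (k i : ℝ)) / ∑ i ∈ Finset.range (t + 1), (C.n i : ℝ)

end Code

/-- The code that an online encoder uses on the size sequence `k`. -/
def OnlineCode.toCode {F : Type u} (C : OnlineCode F) (k : ℕ → ℕ) : Code F k where
  n i := C.n i (fun j => k j)
  enc i := C.enc i (fun j => k j)

/-- An online scheme has to meet both delay constraints on every message size sequence. -/
def OnlineCode.Feasible {F : Type u} (C : OnlineCode F) (τ b τL w m t : ℕ) : Prop :=
  ∀ k, IsSizeSeq τ m t k → (C.toCode k).Feasible τ b τL w t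

/-- The best rate of an offline scheme on the message size sequence `k`. -/
def offlineOptimalRate (F : Type u) (τ b τL w t : ℕ) (k : ℕ → ℕ) : ℝ :=
  sSup {r : ℝ | ∃ C : Code F k, C.Feasible τ b τL w t ∧ C.rate t = r}

end Streaming

end

/-!
The proof exhibits, for each `(τ, b, τL)`, two size sequences that agree up to some time slot `y`
and need different numbers of transmitted symbols up to time slot `y` when they are coded
optimally. As an online encoder cannot tell the sequences apart by then, it sends at least one
symbol more than a certain offline code on one of them, which costs a fixed amount of rate
(`exists_rate_gap`).

*Offline codes.* All codes needed are systematic, and their redundant symbols are sums of message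
symbols, so that they exist over every field. A loss pattern of `C(b, w)` with `w > τ` never takes
two packets whose distance is between `b` and `τ`. Hence a chain of symbols sent `b` slots apart
can share a single sum (`Achievable.chain`). When `τ = p * b + s` with `s ≥ 1`, chains of `p`
symbols each that start at different time slots of `[0, b)` can moreover share one further symbol
in time slot `p * b` (`Achievable.linkedChains`), which beats the rate `p / (p + 1)` of separate
chains.

*Converse.* The encoders are arbitrary functions, so the converse bounds are obtained by counting.
Whatever burst is lost, the rest determines all messages (`Code.Feasible.sum_add_sum_Ico_le`): with
`K` message symbols and `N` transmitted symbols every `b` consecutive packets contain at most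
`N - K` symbols. The lossless constraint bounds initial segments from below
(`Code.Feasible.sum_le_sum_range`). Finally, messages which are determined by the first `b` packets
as well as by the following ones are paid for twice (`Code.Feasible.sum_add_sum_le_sum_range`); for
nonlinear codes this follows from the Cauchy–Schwarz inequality (`card_mul_card_le`).

*The pairs.* Write `τL = (p - 1) * b + r` with `r < b`, and `τ = p * b + s`; outside Regime 1 one
has `s ≥ 1`, and outside Regime 2 `p ≥ 2` or `r ≥ 1`.
* If `p ≥ 2`, then `S[0]` alone should be spread over `p` bursts, but should be sent at once if
  messages follow that fill the next `p * b` slots evenly (`exists_pair_of_two_le`).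
* If `p = 1` and `s ≥ b`, then the message in slot `b - r` should be delayed to slot `b`, away from
  `S[0]`, but should be sent at once if later messages claim that place
  (`exists_pair_of_two_mul_le`).
* If `p = 1` and `s < b`, then half of the message in slot `b - r` should be delayed to slot `b` to
  act as the common symbol of linked chains, unless another message, arriving in slot `b`, plays
  this role (`exists_pair_of_lt_two_mul`).
-/

namespace Streaming

/-! ### Sum-parity codes -/

theorem Code.decodes_iff {F : Type u} [Nonempty F] {k : ℕ → ℕ} (C : Code F k) (t : ℕ)
    (E : Set ℕ) (i T : ℕ) :
    C.Decodes t E i T ↔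
      ∀ S S' : Messages F k, C.received t E T S = C.received t E T S' → S i = S' i := by
  constructor
  · rintro ⟨D, hD⟩ S S' h
    rw [← hD S, ← hD S', h]
  · intro h
    obtain ⟨D, hD⟩ := (Function.factorsThrough_iff (f := C.received t E T)
      (fun S : Messages F k => S i)).1 (fun S S' hS => h S S' hS)
    exact ⟨D, fun S => (congrFun hD S).symm⟩

/-- The layout of a systematic code whose redundant symbols are sums of message symbols: the
message symbol `σ` belongs to the message packet `arr σ` and is sent in time slot `slot σ`; the
sum of the message symbols in `mem π` is sent in time slot `pslot π`. -/
structure ParitySystem where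
  Sym : Type
  Par : Type
  [fintypeSym : Fintype Sym]
  [fintypePar : Fintype Par]
  arr : Sym → ℕ
  slot : Sym → ℕ
  pslot : Par → ℕ
  mem : Par → Finset Sym

namespace ParitySystem

attribute [instance] ParitySystem.fintypeSym ParitySystem.fintypePar

/-- The message symbols that a receiver missing the packets in `E` finds by time slot `T` by
repeatedly solving a received sum for its only unknown term. -/
inductive Known (P : ParitySystem) (E : Set ℕ) (T : ℕ) : P.Sym → Prop
  | direct (σ : P.Sym) (hE : P.slot σ ∉ E) (hT : P.slot σ ≤ T) : Known P E T σ
  | parity (σ : P.Sym) (π : P.Par) (hσ : σ ∈ P.mem π) (hE : P.pslot π ∉ E) (hT : P.pslot π ≤ T)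
      (h : ∀ σ' ∈ P.mem π, σ' ≠ σ → Known P E T σ') : Known P E T σ

theorem Known.mono {P : ParitySystem} {E : Set ℕ} {T T' : ℕ} (hT : T ≤ T') {σ : P.Sym}
    (h : P.Known E T σ) : P.Known E T' σ := by
  induction h with
  | direct σ hE h => exact .direct σ hE (h.trans hT)
  | parity σ π hσ hE h _ ih => exact .parity σ π hσ hE (h.trans hT) ih

/-- Of the loss patterns of `C(b, w)`, `w > τ`, only one property is used: two lost packets at
most `τ` slots apart are less than `b` slots apart. -/
def Spaced (τ b : ℕ) (E : Set ℕ) : Prop :=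
  ∀ j ∈ E, ∀ j', j + b ≤ j' → j' ≤ j + τ → j' ∉ E

/-- The layout is causal and meets both delay constraints. -/
structure Good (P : ParitySystem) (τ b τL : ℕ) : Prop where
  arr_le_slot : ∀ σ, P.arr σ ≤ P.slot σ
  slot_le : ∀ σ, P.slot σ ≤ P.arr σ + τL
  arr_le_pslot : ∀ π, ∀ σ ∈ P.mem π, P.arr σ ≤ P.pslot π
  known : ∀ E, Spaced τ b E → ∀ σ, P.Known E (P.arr σ + τ) σ

theorem spaced_of_isBurstLoss {τ b w : ℕ} (hw : τ < w) {E : Set ℕ} (hE : IsBurstLoss b w E) :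
    Spaced τ b E := by
  intro j hj j' h1 h2 hj'
  obtain ⟨s, l, hl, h⟩ := hE j
  have h3 := (h j le_rfl (by omega)).1 hj
  have h4 := (h j' (by omega) (by omega)).1 hj'
  omega

/-- The sizes of the message packets. -/
def sizes (P : ParitySystem) : ℕ → ℕ := fun i => ∑ σ, if P.arr σ = i then 1 else 0

theorem card_fiber {α : Type*} [Fintype α] (f : α → ℕ) (i : ℕ) :
    Fintype.card {a // f a = i} = ∑ a, if f a = i then 1 else 0 := by
  rw [Fintype.card_subtype, Finset.card_filter]

/-- The number of a message symbol within its message packet. -/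
noncomputable def fiberEquiv (P : ParitySystem) (i : ℕ) : {σ // P.arr σ = i} ≃ Fin (P.sizes i) :=
  Fintype.equivFinOfCardEq (card_fiber P.arr i)

/-- The value of a message symbol. -/
noncomputable def val (P : ParitySystem) {F : Type u} (S : Messages F P.sizes) (σ : P.Sym) : F :=
  S (P.arr σ) (P.fiberEquiv _ ⟨σ, rfl⟩)

theorem eq_of_val_eq (P : ParitySystem) {F : Type u} {S S' : Messages F P.sizes} {i : ℕ}
    (h : ∀ σ, P.arr σ = i → P.val S σ = P.val S' σ) : S i = S' i := by
  funext a
  obtain ⟨⟨σ, rfl⟩, rfl⟩ := (P.fiberEquiv i).surjective a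
  exact h σ rfl

/-- The value of a message symbol in terms of the messages up to time slot `i`. -/
noncomputable def prefixVal (P : ParitySystem) {F : Type u} [Zero F] {i : ℕ}
    (S : Prefix F P.sizes i) (σ : P.Sym) : F :=
  if h : P.arr σ ≤ i then S ⟨P.arr σ, Nat.lt_succ_of_le h⟩ (P.fiberEquiv _ ⟨σ, rfl⟩) else 0

/-- The symbols sent in time slot `i`. -/
abbrev Sent (P : ParitySystem) (i : ℕ) : Type :=
  {σ // P.slot σ = i} ⊕ {π // P.pslot π = i}

/-- The code with layout `P`. -/
noncomputable def toCode (P : ParitySystem) (F : Type u) [AddCommMonoid F] : Code F P.sizes where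
  n i := Fintype.card (P.Sent i)
  enc i S a := Sum.elim (fun σ => P.prefixVal S σ.1)
    (fun π => ∑ σ ∈ P.mem π.1, P.prefixVal S σ) ((Fintype.equivFin (P.Sent i)).symm a)

theorem prefixVal_eq (P : ParitySystem) {F : Type u} [Zero F] (S : Messages F P.sizes) {i : ℕ}
    {σ : P.Sym} (h : P.arr σ ≤ i) :
    P.prefixVal (i := i) (fun j => S j) σ = P.val S σ := by
  rw [prefixVal, dif_pos h, val]

section

variable {P : ParitySystem} {τ b τL : ℕ} {F : Type u}

theorem Good.val_eq_of_packet_eq [AddCommMonoid F] (hP : P.Good τ b τL)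
    {S S' : Messages F P.sizes} (σ : P.Sym)
    (h : (P.toCode F).packet S (P.slot σ) = (P.toCode F).packet S' (P.slot σ)) :
    P.val S σ = P.val S' σ := by
  have h1 := congrFun h (Fintype.equivFin (P.Sent (P.slot σ)) (Sum.inl ⟨σ, rfl⟩))
  simp only [Code.packet, toCode, Equiv.symm_apply_apply, Sum.elim_inl] at h1
  rwa [prefixVal_eq P S (hP.arr_le_slot σ), prefixVal_eq P S' (hP.arr_le_slot σ)] at h1

theorem Good.sum_val_eq_of_packet_eq [AddCommMonoid F] (hP : P.Good τ b τL)
    {S S' : Messages F P.sizes} (π : P.Par)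
    (h : (P.toCode F).packet S (P.pslot π) = (P.toCode F).packet S' (P.pslot π)) :
    ∑ σ ∈ P.mem π, P.val S σ = ∑ σ ∈ P.mem π, P.val S' σ := by
  have h1 := congrFun h (Fintype.equivFin (P.Sent (P.pslot π)) (Sum.inr ⟨π, rfl⟩))
  simp only [Code.packet, toCode, Equiv.symm_apply_apply, Sum.elim_inr] at h1
  rwa [Finset.sum_congr rfl fun σ hσ => prefixVal_eq P S (hP.arr_le_pslot π σ hσ),
    Finset.sum_congr rfl fun σ hσ => prefixVal_eq P S' (hP.arr_le_pslot π σ hσ)] at h1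

theorem packet_eq_of_received_eq {k : ℕ → ℕ} {C : Code F k} {t T j : ℕ} {E : Set ℕ}
    {S S' : Messages F k} (h : C.received t E T S = C.received t E T S')
    (hj : j ≤ t) (hT : j ≤ T) (hE : j ∉ E) : C.packet S j = C.packet S' j := by
  have h1 := congrFun h j
  simp only [Code.received] at h1
  rw [if_pos ⟨hj, hT, hE⟩, if_pos ⟨hj, hT, hE⟩] at h1
  exact Option.some.inj h1

/-- Solving the received sums one by one really recovers the symbols. -/
theorem Known.val_eq [AddCommGroup F] (hP : P.Good τ b τL) {t T : ℕ} {E : Set ℕ}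
    (ht : ∀ σ, P.slot σ ≤ t) (ht' : ∀ π, P.pslot π ≤ t) {S S' : Messages F P.sizes}
    (h : (P.toCode F).received t E T S = (P.toCode F).received t E T S') {σ : P.Sym}
    (hσ : P.Known E T σ) : P.val S σ = P.val S' σ := by
  classical
  induction hσ with
  | direct σ hE hT =>
    exact hP.val_eq_of_packet_eq σ (packet_eq_of_received_eq h (ht σ) hT hE)
  | parity σ π hσ hE hT _ ih =>
    have h1 := hP.sum_val_eq_of_packet_eq π (packet_eq_of_received_eq h (ht' π) hT hE)
    rw [← Finset.add_sum_erase _ _ hσ, ← Finset.add_sum_erase _ _ hσ,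
      Finset.sum_congr rfl fun σ' hσ' =>
        ih σ' (Finset.mem_of_mem_erase hσ') (Finset.ne_of_mem_erase hσ')] at h1
    exact add_right_cancel h1

theorem Good.feasible [AddCommGroup F] (hP : P.Good τ b τL) {w t : ℕ} (hw : τ < w)
    (ht : ∀ σ, P.slot σ ≤ t) (ht' : ∀ π, P.pslot π ≤ t) :
    (P.toCode F).Feasible τ b τL w t := by
  refine ⟨fun E hE i _ => ?_, fun i _ => ?_⟩
  · rw [Code.decodes_iff]
    intro S S' h
    refine P.eq_of_val_eq fun σ hσ => Known.val_eq hP ht ht' h ?_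
    rw [← hσ]
    exact hP.known E (spaced_of_isBurstLoss hw hE) σ
  · rw [Code.decodes_iff]
    intro S S' h
    refine P.eq_of_val_eq fun σ hσ => Known.val_eq hP ht ht' h ?_
    rw [← hσ]
    exact .direct σ (Set.notMem_empty _) (hP.slot_le σ)

end

theorem sum_card_fiber {α : Type*} [Fintype α] (f : α → ℕ) {t : ℕ} (ht : ∀ a, f a ≤ t) :
    ∑ i ∈ Finset.range (t + 1), Fintype.card {a // f a = i} = Fintype.card α := by
  simp only [card_fiber]
  rw [Finset.sum_comm, Finset.sum_congr rfl (g := fun _ => 1), Finset.sum_const, smul_eq_mul,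
    mul_one, Finset.card_univ]
  intro a _
  rw [Finset.sum_ite_eq, if_pos (Finset.mem_range.2 (Nat.lt_succ_of_le (ht a)))]

theorem sum_toCode_n (P : ParitySystem) (F : Type u) [AddCommMonoid F] {t : ℕ}
    (ht : ∀ σ, P.slot σ ≤ t) (ht' : ∀ π, P.pslot π ≤ t) :
    ∑ i ∈ Finset.range (t + 1), (P.toCode F).n i = Fintype.card P.Sym + Fintype.card P.Par := by
  simp only [toCode, Fintype.card_sum]
  rw [Finset.sum_add_distrib, sum_card_fiber _ ht, sum_card_fiber _ ht']

end ParitySystem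

/-- Some sum-parity code for the size sequence `k` meets both delay constraints and sends `N`
symbols in total. -/
def Achievable (τ b τL : ℕ) (k : ℕ → ℕ) (N : ℕ) : Prop :=
  ∃ P : ParitySystem, P.Good τ b τL ∧ P.sizes = k ∧ Fintype.card P.Sym + Fintype.card P.Par = N

namespace Achievable

variable {τ b τL : ℕ} {k k' : ℕ → ℕ} {N N' : ℕ}

theorem exists_code (h : Achievable τ b τL k N) :
    ∃ t₀, ∀ t, t₀ ≤ t → ∀ w, τ < w → ∀ (F : Type u) [AddCommGroup F],
      ∃ C : Code F k, C.Feasible τ b τL w t ∧ ∑ i ∈ Finset.range (t + 1), C.n i = N := by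
  obtain ⟨P, hP, rfl, rfl⟩ := h
  refine ⟨(∑ σ, P.slot σ) + ∑ π, P.pslot π, fun t ht w hw F _ => ⟨P.toCode F, ?_, ?_⟩⟩
  all_goals
    have h1 : ∀ σ, P.slot σ ≤ t := fun σ =>
      (Finset.single_le_sum (f := P.slot) (fun _ _ => Nat.zero_le _) (Finset.mem_univ σ)).trans
        (by omega)
    have h2 : ∀ π, P.pslot π ≤ t := fun π =>
      (Finset.single_le_sum (f := P.pslot) (fun _ _ => Nat.zero_le _) (Finset.mem_univ π)).trans
        (by omega)
  · exact hP.feasible hw h1 h2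
  · exact P.sum_toCode_n F h1 h2

theorem exists_isSizeSeq (h : Achievable τ b τL k N) :
    ∃ t₀, ∀ t, t₀ ≤ t → ∀ m, N ≤ m → IsSizeSeq τ m t k := by
  obtain ⟨P, hP, rfl, rfl⟩ := h
  refine ⟨τ + ∑ σ, P.arr σ, fun t ht m hm => ⟨by omega, fun i => ?_, fun i hi => ?_⟩⟩
  · have : P.sizes i ≤ Fintype.card P.Sym := by
      rw [ParitySystem.sizes, ← ParitySystem.card_fiber]
      exact Fintype.card_subtype_le _
    omega
  · refine Finset.sum_eq_zero fun σ _ => if_neg fun hσ => ?_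
    have := Finset.single_le_sum (f := P.arr) (fun _ _ => Nat.zero_le _) (Finset.mem_univ σ)
    omega

theorem zero : Achievable τ b τL 0 0 :=
  ⟨⟨Empty, Empty, Empty.elim, Empty.elim, Empty.elim, fun π => π.elim⟩,
    ⟨fun σ => σ.elim, fun σ => σ.elim, fun σ => σ.elim, fun _ _ σ => σ.elim⟩,
    rfl, rfl⟩

/-- Two codes may be run side by side. -/
theorem add (h : Achievable τ b τL k N) (h' : Achievable τ b τL k' N') :
    Achievable τ b τL (k + k') (N + N') := by
  obtain ⟨P, hP, rfl, rfl⟩ := h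
  obtain ⟨Q, hQ, rfl, rfl⟩ := h'
  let R : ParitySystem :=
    { Sym := P.Sym ⊕ Q.Sym
      Par := P.Par ⊕ Q.Par
      arr := Sum.elim P.arr Q.arr
      slot := Sum.elim P.slot Q.slot
      pslot := Sum.elim P.pslot Q.pslot
      mem := Sum.elim (fun π => (P.mem π).map .inl) (fun π => (Q.mem π).map .inr) }
  have hl : ∀ E T σ, P.Known E T σ → R.Known E T (Sum.inl σ) := by
    intro E T σ hσ
    induction hσ with
    | direct σ hE hT => exact .direct _ hE hT
    | parity σ π hσ hE hT _ ih =>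
      refine .parity _ (Sum.inl π) (Finset.mem_map_of_mem _ hσ) hE hT fun σ' hσ' hne => ?_
      obtain ⟨ρ, hρ, rfl⟩ := Finset.mem_map.1 hσ'
      exact ih ρ hρ fun h => hne (congrArg _ h)
  have hr : ∀ E T σ, Q.Known E T σ → R.Known E T (Sum.inr σ) := by
    intro E T σ hσ
    induction hσ with
    | direct σ hE hT => exact .direct _ hE hT
    | parity σ π hσ hE hT _ ih =>
      refine .parity _ (Sum.inr π) (Finset.mem_map_of_mem _ hσ) hE hT fun σ' hσ' hne => ?_
      obtain ⟨ρ, hρ, rfl⟩ := Finset.mem_map.1 hσ'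
      exact ih ρ hρ fun h => hne (congrArg _ h)
  refine ⟨R, ⟨?_, ?_, ?_, ?_⟩, ?_, ?_⟩
  · rintro (σ | σ)
    exacts [hP.arr_le_slot σ, hQ.arr_le_slot σ]
  · rintro (σ | σ)
    exacts [hP.slot_le σ, hQ.slot_le σ]
  · rintro (π | π) σ hσ
    · obtain ⟨ρ, hρ, rfl⟩ := Finset.mem_map.1 hσ
      exact hP.arr_le_pslot π ρ hρ
    · obtain ⟨ρ, hρ, rfl⟩ := Finset.mem_map.1 hσ
      exact hQ.arr_le_pslot π ρ hρ
  · rintro E hE (σ | σ)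
    exacts [hl _ _ _ (hP.known E hE σ), hr _ _ _ (hQ.known E hE σ)]
  · funext i
    exact Fintype.sum_sum_type _
  · have h1 : Fintype.card R.Sym = Fintype.card P.Sym + Fintype.card Q.Sym := Fintype.card_sum
    have h2 : Fintype.card R.Par = Fintype.card P.Par + Fintype.card Q.Par := Fintype.card_sum
    omega

theorem sum {ι : Type*} (I : Finset ι) {k : ι → ℕ → ℕ} {N : ι → ℕ}
    (h : ∀ i ∈ I, Achievable τ b τL (k i) (N i)) :
    Achievable τ b τL (∑ i ∈ I, k i) (∑ i ∈ I, N i) := by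
  classical
  induction I using Finset.induction_on with
  | empty => exact zero
  | insert a I ha ih =>
    rw [Finset.sum_insert ha, Finset.sum_insert ha]
    exact (h a (Finset.mem_insert_self a I)).add
      (ih fun i hi => h i (Finset.mem_insert_of_mem hi))

theorem nsmul (h : Achievable τ b τL k N) (c : ℕ) : Achievable τ b τL (c • k) (c * N) := by
  simpa using sum (Finset.range c) (k := fun _ => k) (N := fun _ => N) fun _ _ => h

end Achievable

/-! ### Chains of symbols with a common sum -/

/-- The size sequence with a single message symbol, which arrives in time slot `a`. -/
def unitSize (a : ℕ) : ℕ → ℕ := fun i => if a = i then 1 else 0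

namespace Achievable

open ParitySystem

variable {τ b τL : ℕ}

/-- Symbols sent `b` slots apart are never lost together, nor together with a sum sent
at least `b` slots after the last of them, so one sum protects them all. -/
theorem chain (hb : 1 ≤ b) (len x v : ℕ) (a : ℕ → ℕ) (hv : x + len * b ≤ v) (hvτ : v ≤ x + τ)
    (ha : ∀ i < len, x ≤ a i ∧ a i ≤ x + i * b ∧ x + i * b ≤ a i + τL) :
    Achievable τ b τL (∑ i ∈ Finset.range len, unitSize (a i)) (len + 1) := by
  let P : ParitySystem :=
    { Sym := Fin len
      Par := Unit
      arr := fun i => a i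
      slot := fun i => x + i * b
      pslot := fun _ => v
      mem := fun _ => Finset.univ }
  have hlt : ∀ {i j : ℕ}, i < j → x + i * b + b ≤ x + j * b := by
    intro i j hij
    nlinarith
  refine ⟨P, ⟨fun i => (ha i i.2).2.1, fun i => (ha i i.2).2.2, fun _ i _ => ?_, ?_⟩, ?_, ?_⟩
  · have h1 := hlt i.2
    have h2 := (ha i i.2).2.1
    change a i ≤ v
    omega
  · intro E hE i
    have hi := ha i i.2
    have hi' := hlt i.2
    by_cases h : x + i * b ∈ E
    · refine .parity i () (Finset.mem_univ i) (hE _ h v ?_ ?_) (?_ : v ≤ a i + τ) ?_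
      · omega
      · omega
      · omega
      · intro j _ hji
        have hj := hlt j.2
        refine .direct j (fun hj' => ?_) (?_ : x + j * b ≤ a i + τ)
        · change x + j * b ∈ E at hj'
          rcases lt_or_gt_of_ne (Fin.val_ne_of_ne hji) with hlt' | hlt'
          · have := hlt hlt'
            exact hE _ hj' (x + i * b) (by omega) (by omega) h
          · have := hlt hlt'
            exact hE _ h (x + j * b) (by omega) (by omega) hj'
        · omega
    · exact .direct i h (by change x + i * b ≤ a i + τ; omega)
  · funext i
    rw [Finset.sum_apply, Finset.sum_range]
    rfl
  · change Fintype.card (Fin len) + Fintype.card Unit = len + 1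
    simp

/-- Chains of `p` symbols, `b` slots apart, start in the time slots `x ∈ H ⊆ [0, b)`, where
consecutive elements of `H` differ by at most `s`; one further symbol, sent in
time slot `p * b`, is added to the sum of every chain, and the sum of the chain `x` is sent as
late as possible, in time slot `x + τ`. The numbers `a x l` and `d` are the arrival times. When
the common symbol is lost together with the last symbols of some chains, then the sum of the chain
before the first of these is received and free of other losses: it yields the common symbol, after
which all other chains can be solved. When no last symbol is lost with it, the chain `h` yields the
common symbol. -/
theorem linkedChains (hb : 1 ≤ b) (p s : ℕ) (hp : 1 ≤ p) (hτ : τ = p * b + s) (H : Finset ℕ)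
    (hH : ∀ x ∈ H, x < b) (hpred : ∀ x ∈ H, x ≠ 0 → ∃ y ∈ H, y < x ∧ x ≤ y + s)
    (h : ℕ) (hhH : h ∈ H) (hhs : b ≤ h + s) (a : ℕ → ℕ → ℕ) (d : ℕ)
    (ha : ∀ x ∈ H, ∀ l < p, x ≤ a x l ∧ a x l ≤ x + l * b ∧ x + l * b ≤ a x l + τL)
    (hd : ∀ x ∈ H, x ≤ d) (hdp : d ≤ p * b) (hdL : p * b ≤ d + τL) :
    Achievable τ b τL (∑ x ∈ H, ∑ l ∈ Finset.range p, unitSize (a x l) + unitSize d)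
      (H.card * p + 1 + H.card) := by
  classical
  let P : ParitySystem :=
    { Sym := (H × Fin p) ⊕ Unit
      Par := H
      arr := Sum.elim (fun q => a q.1 q.2) (fun _ => d)
      slot := Sum.elim (fun q => q.1 + q.2 * b) (fun _ => p * b)
      pslot := fun x => x + τ
      mem := fun x => Finset.univ.filter fun σ => ∀ q, σ = Sum.inl q → q.1 = x }
  have hlt : ∀ {i j : ℕ}, i < j → i * b + b ≤ j * b := by
    intro i j hij
    nlinarith
  have hmem : ∀ x : H, ∀ l : Fin p, (Sum.inl (x, l) : P.Sym) ∈ P.mem x := by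
    intro x l
    refine Finset.mem_filter.2 ⟨Finset.mem_univ _, ?_⟩
    rintro q hq
    rw [← Sum.inl.inj hq]
  have hmem' : ∀ x : H, (Sum.inr () : P.Sym) ∈ P.mem x := by
    intro x
    refine Finset.mem_filter.2 ⟨Finset.mem_univ _, ?_⟩
    rintro q hq
    cases hq
  have hmemcases : ∀ x : H, ∀ σ ∈ P.mem x, σ = Sum.inr () ∨ ∃ l, σ = Sum.inl (x, l) := by
    rintro x (⟨y, l⟩ | ⟨⟩) hσ
    · right
      have := (Finset.mem_filter.1 hσ).2 (y, l) rfl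
      change y = x at this
      exact ⟨l, by rw [this]⟩
    · exact Or.inl rfl
  obtain ⟨p', rfl⟩ : ∃ p', p = p' + 1 := ⟨p - 1, by omega⟩
  have hpb : (p' + 1) * b = p' * b + b := by ring
  -- The common symbol is found from a chain whose last symbol is received.
  have hcommon : ∀ E, Spaced τ b E → (p' + 1) * b ∈ E → ∀ y : H, ∀ T, (y : ℕ) + τ ≤ T →
      (y : ℕ) + p' * b ∉ E → (y : ℕ) + τ ∉ E → P.Known E T (Sum.inr ()) := by
    intro E hE hD y T hT hy hyE
    refine .parity _ y (hmem' y) hyE hT fun σ hσ hne => ?_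
    obtain rfl | ⟨l, rfl⟩ := hmemcases y σ hσ
    · exact absurd rfl hne
    · have hyb := hH y y.2
      have hl : (l : ℕ) * b ≤ p' * b := Nat.mul_le_mul_right b (Nat.lt_succ_iff.1 l.2)
      refine .direct _ (fun hlE => ?_) (?_ : (y : ℕ) + l * b ≤ T)
      · change (y : ℕ) + l * b ∈ E at hlE
        by_cases hlp : (l : ℕ) = p'
        · rw [hlp] at hlE
          exact hy hlE
        · have := hlt (i := l) (j := p') (by omega)
          exact hE _ hlE _ (by omega) (by omega) hD
      · omega
  -- If some last symbol `x` is lost together with the common one, the latter is found by `x + τ`.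
  have hcommon' : ∀ E, Spaced τ b E → (p' + 1) * b ∈ E → ∀ x : H, (x : ℕ) + p' * b ∈ E →
      P.Known E (x + τ) (Sum.inr ()) := by
    intro E hE hD x hx
    have hex : ∃ n, n ∈ H ∧ n + p' * b ∈ E := ⟨x, x.2, hx⟩
    have hn := Nat.find_spec hex
    have hnx : Nat.find hex ≤ x := Nat.find_min' hex ⟨x.2, hx⟩
    have hmin := fun m => Nat.find_min (H := hex) (m := m)
    generalize Nat.find hex = n at hn hnx hmin
    -- The last symbol of the chain `0` and the common symbol are `b` slots apart.
    have hn0 : n ≠ 0 := by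
      rintro rfl
      exact hE _ hn.2 _ (by omega) (by omega) hD
    obtain ⟨y, hy, hyn, hys⟩ := hpred n hn.1 hn0
    refine hcommon E hE hD ⟨y, hy⟩ _ (by change y + τ ≤ _; omega) (fun hyE => hmin y hyn ⟨hy, hyE⟩)
      (hE _ hn.2 _ ?_ ?_)
    · change _ ≤ y + τ
      omega
    · change y + τ ≤ _
      omega
  refine ⟨P, ⟨?_, ?_, ?_, ?_⟩, ?_, ?_⟩
  · rintro (⟨x, l⟩ | ⟨⟩)
    exacts [(ha x x.2 l l.2).2.1, hdp]
  · rintro (⟨x, l⟩ | ⟨⟩)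
    exacts [(ha x x.2 l l.2).2.2, hdL]
  · intro x σ hσ
    obtain rfl | ⟨l, rfl⟩ := hmemcases x σ hσ
    · change d ≤ x + τ
      omega
    · have h1 := (ha x x.2 l l.2).2.1
      have h2 := hlt l.2
      change a x l ≤ x + τ
      omega
  · rintro E hE (⟨x, l⟩ | ⟨⟩)
    · have h1 := ha x x.2 l l.2
      have h2 := hlt l.2
      have hxb := hH x x.2
      change P.Known E (a x l + τ) _
      by_cases hxl : (x : ℕ) + l * b ∈ E
      · refine .parity _ x (hmem x l) (hE _ hxl (x + τ) (by omega) (by omega))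
          (by change (x : ℕ) + τ ≤ _; omega) fun σ hσ hne => ?_
        obtain rfl | ⟨j, rfl⟩ := hmemcases x σ hσ
        · by_cases hD : (p' + 1) * b ∈ E
          · have hlp : (l : ℕ) = p' := by
              by_contra hlp
              have := hlt (i := l) (j := p') (by omega)
              exact hE _ hxl _ (by omega) (by omega) hD
            rw [hlp] at hxl
            have hK := hcommon' E hE hD x hxl
            exact hK.mono (by omega)
          · exact .direct _ hD (by change (p' + 1) * b ≤ a x l + τ; omega)
        · have hjl : (j : ℕ) ≠ l := fun hjl => hne (by rw [Fin.ext hjl])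
          have h3 := hlt j.2
          refine .direct _ (fun hj => ?_) (?_ : (x : ℕ) + j * b ≤ a x l + τ)
          · change (x : ℕ) + j * b ∈ E at hj
            rcases lt_or_gt_of_ne hjl with hlt' | hlt'
            · have := hlt hlt'
              exact hE _ hj _ (by omega) (by omega) hxl
            · have := hlt hlt'
              exact hE _ hxl _ (by omega) (by omega) hj
          · omega
      · exact .direct _ hxl (by change (x : ℕ) + l * b ≤ _; omega)
    · change P.Known E (d + τ) _
      by_cases hD : (p' + 1) * b ∈ E
      · have hhd := hd h hhH
        by_cases hh : h + p' * b ∈ E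
        · have hK := hcommon' E hE hD ⟨h, hhH⟩ hh
          exact hK.mono (by change h + τ ≤ _; omega)
        · have := hH h hhH
          exact hcommon E hE hD ⟨h, hhH⟩ _ (by change h + τ ≤ _; omega) hh
            (hE _ hD _ (by change _ ≤ h + τ; omega) (by change h + τ ≤ _; omega))
      · exact .direct _ hD (by change (p' + 1) * b ≤ _; omega)
  · funext i
    change ∑ σ : (H × Fin (p' + 1)) ⊕ Unit, _ = _
    rw [Fintype.sum_sum_type, Fintype.sum_prod_type, Pi.add_apply, Finset.sum_apply,
      ← Finset.sum_coe_sort H]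
    simp only [Finset.sum_apply, Finset.sum_range]
    rfl
  · change Fintype.card ((H × Fin (p' + 1)) ⊕ Unit) + Fintype.card H = _
    simp

end Achievable

/-! ### Counting bounds for arbitrary codes -/

open Classical in
theorem sum_card_image_fiber_le {M A W : Type*} [Fintype M] [Fintype A] [Fintype W]
    (α : M → A) (h : M → W) (hα : ∀ x y, h x = h y → α x = α y) :
    ∑ a, ((Finset.univ.filter fun x => α x = a).image h).card ≤ Fintype.card W := by
  rw [← Finset.card_biUnion]
  · exact Finset.card_le_univ _
  · intro a _ a' _ haa'
    refine Finset.disjoint_left.2 fun w hw hw' => haa' ?_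
    obtain ⟨x, hx, rfl⟩ := Finset.mem_image.1 hw
    obtain ⟨y, hy, hxy⟩ := Finset.mem_image.1 hw'
    rw [← (Finset.mem_filter.1 hx).2, ← (Finset.mem_filter.1 hy).2]
    exact hα _ _ hxy.symm

theorem card_sq_mul_le_sum_mul_sum {A : Type*} [Fintype A] {u v : A → ℕ} {c : ℕ}
    (h : ∀ a, c ≤ u a * v a) : Fintype.card A ^ 2 * c ≤ (∑ a, u a) * ∑ a, v a := by
  have hcs := Finset.sum_mul_sq_le_sq_mul_sq (Finset.univ : Finset A)
    (fun a => √(u a : ℝ)) (fun a => √(v a : ℝ))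
  simp only [Real.sq_sqrt (Nat.cast_nonneg _)] at hcs
  have hlow : (Fintype.card A : ℝ) * √(c : ℝ) ≤ ∑ a, √(u a : ℝ) * √(v a : ℝ) := by
    rw [← nsmul_eq_mul, ← Finset.card_univ]
    refine Finset.card_nsmul_le_sum _ _ _ fun a _ => ?_
    rw [← Real.sqrt_mul (Nat.cast_nonneg _)]
    exact Real.sqrt_le_sqrt (by exact_mod_cast h a)
  have h1 := (pow_le_pow_left₀ (by positivity) hlow 2).trans hcs
  rw [mul_pow, Real.sq_sqrt (Nat.cast_nonneg _)] at h1
  exact_mod_cast h1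

/-- If `f` and `g` both determine `α` and jointly determine the point, then
`|A| ^ 2 * c ≤ |U| * |V|` when all fibres of `α` have at least `c` points: for values `a ≠ a'` the
images under `f` of the two fibres are disjoint, likewise for `g`, and the product of the image sizes of
each fibre is at least its size. The Cauchy–Schwarz inequality adds these bounds up. -/
theorem card_mul_card_le {M A U V : Type*} [Fintype M] [Fintype A] [Fintype U] [Fintype V]
    (α : M → A) (f : M → U) (g : M → V) (c : ℕ)
    (hα : ∀ a, c ≤ Nat.card {x // α x = a})
    (hf : ∀ x y, f x = f y → α x = α y) (hg : ∀ x y, g x = g y → α x = α y)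
    (hfg : ∀ x y, f x = f y → g x = g y → x = y) :
    Fintype.card A ^ 2 * c ≤ Fintype.card U * Fintype.card V := by
  classical
  let fib : A → Finset M := fun a => Finset.univ.filter fun x => α x = a
  have hU := sum_card_image_fiber_le α f hf
  have hV := sum_card_image_fiber_le α g hg
  have hprod : ∀ a, c ≤ ((fib a).image f).card * ((fib a).image g).card := by
    intro a
    refine (hα a).trans ?_
    rw [Nat.card_eq_fintype_card, Fintype.card_subtype, ← Finset.card_product]
    refine Finset.card_le_card_of_injOn (fun x => (f x, g x)) (fun x hx => ?_) ?_
    · exact Finset.mem_coe.2 (Finset.mem_product.2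
        ⟨Finset.mem_image_of_mem f hx, Finset.mem_image_of_mem g hx⟩)
    · intro x _ y _ hxy
      exact hfg x y (congrArg Prod.fst hxy) (congrArg Prod.snd hxy)
  exact (card_sq_mul_le_sum_mul_sum hprod).trans (Nat.mul_le_mul hU hV)

namespace Code

variable {F : Type u} {k : ℕ → ℕ}

/-- Tuples of symbols of `F`, indexed by a finite set of time slots. -/
abbrev Block (F : Type u) (n : ℕ → ℕ) (I : Finset ℕ) : Type u := (i : I) → Fin (n i) → F

theorem card_block [Fintype F] (n : ℕ → ℕ) (I : Finset ℕ) :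
    Fintype.card (Block F n I) = Fintype.card F ^ ∑ i ∈ I, n i := by
  classical
  rw [Fintype.card_pi, ← Finset.prod_pow_eq_pow_sum, ← Finset.prod_coe_sort I]
  exact Finset.prod_congr rfl fun i _ => by simp

/-- The messages which agree with `f` on the time slots in `I` and are zero elsewhere. -/
def extend [Zero F] {I : Finset ℕ} (f : Block F k I) : Messages F k :=
  fun i => if h : i ∈ I then f ⟨i, h⟩ else 0

theorem extend_of_mem [Zero F] {I : Finset ℕ} (f : Block F k I) (i : I) :
    extend f i = f i := by
  rw [extend, dif_pos i.2]

theorem extend_of_notMem [Zero F] {I : Finset ℕ} (f : Block F k I) {i : ℕ} (hi : i ∉ I) :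
    extend f i = 0 := by
  rw [extend, dif_neg hi]

theorem extend_injective [Zero F] {I : Finset ℕ} {f g : Block F k I}
    (h : ∀ i ∈ I, extend f i = extend g i) : f = g := by
  funext i
  rw [← extend_of_mem f, ← extend_of_mem g, h i i.2]

/-- The packets sent in the time slots in `J`. -/
def packets (C : Code F k) (J : Finset ℕ) (S : Messages F k) : Block F C.n J :=
  fun j => C.packet S j

theorem packet_eq_of_packets_eq {C : Code F k} {J : Finset ℕ} {S S' : Messages F k}
    (h : C.packets J S = C.packets J S') {j : ℕ} (hj : j ∈ J) :
    C.packet S j = C.packet S' j :=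
  congrFun h ⟨j, hj⟩

/-- If the packets in `J` determine the messages in `I`, they carry at least as many symbols. -/
theorem sum_le_sum_of_determines [Field F] [Fintype F] (C : Code F k) (I J : Finset ℕ)
    (h : ∀ S S' : Messages F k, (∀ i ∉ I, S i = S' i) →
      (∀ j ∈ J, C.packet S j = C.packet S' j) → ∀ i ∈ I, S i = S' i) :
    ∑ i ∈ I, k i ≤ ∑ j ∈ J, C.n j := by
  classical
  have hinj : Function.Injective fun f : Block F k I => C.packets J (extend f) := by
    intro f g hfg
    refine extend_injective (h _ _ (fun i hi => ?_) fun j hj => packet_eq_of_packets_eq hfg hj)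
    rw [extend_of_notMem f hi, extend_of_notMem g hi]
  have hcard := Fintype.card_le_of_injective _ hinj
  rw [card_block, card_block] at hcard
  exact (Nat.pow_le_pow_iff_right Fintype.one_lt_card).1 hcard

/-- If the messages in `A ⊆ I` are determined by the packets in `J` as well as by those in `J'`,
and the messages in `I` by both together, then the symbols of `A` are counted twice. -/
theorem sum_add_sum_le_of_determines [Field F] [Fintype F] (C : Code F k) {A I : Finset ℕ}
    (hAI : A ⊆ I) (J J' : Finset ℕ)
    (hJ : ∀ S S' : Messages F k, (∀ i ∉ I, S i = S' i) →
      (∀ j ∈ J, C.packet S j = C.packet S' j) → ∀ i ∈ A, S i = S' i)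
    (hJ' : ∀ S S' : Messages F k, (∀ i ∉ I, S i = S' i) →
      (∀ j ∈ J', C.packet S j = C.packet S' j) → ∀ i ∈ A, S i = S' i)
    (hJJ' : ∀ S S' : Messages F k, (∀ i ∉ I, S i = S' i) →
      (∀ j ∈ J, C.packet S j = C.packet S' j) →
      (∀ j ∈ J', C.packet S j = C.packet S' j) → ∀ i ∈ I, S i = S' i) :
    ∑ i ∈ I, k i + ∑ i ∈ A, k i ≤ ∑ j ∈ J, C.n j + ∑ j ∈ J', C.n j := by
  classical
  have hout : ∀ f g : Block F k I, ∀ i ∉ I, extend f i = extend g i := fun f g i hi => by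
    rw [extend_of_notMem f hi, extend_of_notMem g hi]
  let α : Block F k I → Block F k A := fun f i => f ⟨i, hAI i.2⟩
  have hα : ∀ f g : Block F k I, (∀ i ∈ A, extend f i = extend g i) → α f = α g := by
    intro f g h
    funext i
    have := h i i.2
    rwa [extend_of_mem f ⟨i, hAI i.2⟩, extend_of_mem g ⟨i, hAI i.2⟩] at this
  have hfib : ∀ a, Fintype.card F ^ ∑ i ∈ I \ A, k i ≤ Nat.card {f // α f = a} := by
    intro a
    rw [← card_block, ← Nat.card_eq_fintype_card]
    -- A prescribed value on `A` is completed by arbitrary values on `I \ A`.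
    let φ : Block F k (I \ A) → Block F k I := fun f i =>
      if h : (i : ℕ) ∈ A then a ⟨i, h⟩ else f ⟨i, Finset.mem_sdiff.2 ⟨i.2, h⟩⟩
    have hφ : ∀ f, α (φ f) = a := by
      intro f
      funext i
      exact dif_pos i.2
    refine Nat.card_le_card_of_injective (fun f => ⟨φ f, hφ f⟩) fun f g hfg => ?_
    funext i
    have hi := Finset.mem_sdiff.1 i.2
    have h1 := congrFun (congrArg Subtype.val hfg) ⟨i, hi.1⟩
    simp only [φ] at h1
    rwa [dif_neg hi.2, dif_neg hi.2] at h1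
  have hmain := card_mul_card_le α (fun f => C.packets J (extend f))
    (fun f => C.packets J' (extend f)) _ hfib
    (fun f g h => hα f g (hJ _ _ (hout f g) fun j hj => packet_eq_of_packets_eq h hj))
    (fun f g h => hα f g (hJ' _ _ (hout f g) fun j hj => packet_eq_of_packets_eq h hj))
    (fun f g h h' => extend_injective (hJJ' _ _ (hout f g)
      (fun j hj => packet_eq_of_packets_eq h hj) fun j hj => packet_eq_of_packets_eq h' hj))
  rw [card_block, card_block, card_block, ← pow_mul, ← pow_add, ← pow_add] at hmain
  have h2 := (Nat.pow_le_pow_iff_right Fintype.one_lt_card).1 hmain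
  have h3 := Finset.sum_sdiff (f := k) hAI
  omega

theorem received_eq {C : Code F k} {t T : ℕ} {E : Set ℕ} {S S' : Messages F k}
    (h : ∀ j, j ≤ t → j ≤ T → j ∉ E → C.packet S j = C.packet S' j) :
    C.received t E T S = C.received t E T S' := by
  funext j
  by_cases hj : j ≤ t ∧ j ≤ T ∧ j ∉ E
  · simp only [received, if_pos hj, h j hj.1 hj.2.1 hj.2.2]
  · simp only [received, if_neg hj]

theorem isBurstLoss_Ico {b w s : ℕ} : IsBurstLoss b w (Set.Ico s (s + b)) :=
  fun _ => ⟨s, b, le_rfl, fun _ _ _ => Iff.rfl⟩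

namespace Feasible

variable [Field F] {C : Code F k} {τ b τL w t : ℕ}

theorem eq_of_burst (hC : C.Feasible τ b τL w t) (s : ℕ) {S S' : Messages F k} {i : ℕ}
    (hi : i ≤ t)
    (h : ∀ j, j ≤ t → j ≤ i + τ → ¬ (s ≤ j ∧ j < s + b) → C.packet S j = C.packet S' j) :
    S i = S' i :=
  (C.decodes_iff t _ i _).1 (hC.1 _ isBurstLoss_Ico i hi) S S' (received_eq h)

theorem eq_of_lossless (hC : C.Feasible τ b τL w t) {S S' : Messages F k} {i : ℕ}
    (hi : i ≤ t) (h : ∀ j, j ≤ t → j ≤ i + τL → C.packet S j = C.packet S' j) : S i = S' i :=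
  (C.decodes_iff t _ i _).1 (hC.2 i hi) S S' (received_eq fun j h1 h2 _ => h j h1 h2)

variable [Fintype F]

/-- Whatever burst is lost, the remaining packets determine all messages. -/
theorem sum_add_sum_Ico_le (hC : C.Feasible τ b τL w t) {s M : ℕ} (hM : M ≤ t + 1)
    (hs : s + b ≤ t + 1) :
    ∑ i ∈ Finset.range M, k i + ∑ j ∈ Finset.Ico s (s + b), C.n j ≤
      ∑ j ∈ Finset.range (t + 1), C.n j := by
  have hsub : Finset.Ico s (s + b) ⊆ Finset.range (t + 1) := fun j hj => by
    simp only [Finset.mem_Ico, Finset.mem_range] at *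
    omega
  have h := C.sum_le_sum_of_determines (Finset.range M)
    (Finset.range (t + 1) \ Finset.Ico s (s + b)) fun S S' _ h i hi => by
      rw [Finset.mem_range] at hi
      exact hC.eq_of_burst s (by omega) fun j h1 _ h2 => h j
        (Finset.mem_sdiff.2 ⟨Finset.mem_range.2 (by omega), by rwa [Finset.mem_Ico]⟩)
  have := Finset.sum_sdiff (f := C.n) hsub
  omega

/-- The messages due by time slot `T` if nothing is lost fit into the packets up to then. -/
theorem sum_le_sum_range (hC : C.Feasible τ b τL w t) {M T : ℕ} (hM : M + τL ≤ T + 1)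
    (hMt : M ≤ t + 1) :
    ∑ i ∈ Finset.range M, k i ≤ ∑ j ∈ Finset.range (T + 1), C.n j :=
  C.sum_le_sum_of_determines _ _ fun S S' _ h i hi => by
    rw [Finset.mem_range] at hi
    exact hC.eq_of_lossless (by omega) fun j _ h2 => h j (Finset.mem_range.2 (by omega))

/-- The messages `S[0], …, S[z]` are determined by the first `b` packets, and, in case of a burst
that starts in time slot `0`, also by the packets that follow these up to time slot `z + τ`. So
their symbols are sent twice by then. -/
theorem sum_add_sum_le_sum_range (hC : C.Feasible τ b τL w t) {z M : ℕ} (hz : z + τL < b)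
    (hbτ : b ≤ τ) (hzM : z < M) (hM : M + τL ≤ z + τ + 1) (ht : z + τ ≤ t) :
    ∑ i ∈ Finset.range M, k i + ∑ i ∈ Finset.range (z + 1), k i ≤
      ∑ j ∈ Finset.range (z + τ + 1), C.n j := by
  have h := C.sum_add_sum_le_of_determines (A := Finset.range (z + 1)) (I := Finset.range M)
    (Finset.range_subset_range.2 hzM) (Finset.range b) (Finset.Ico b (z + τ + 1))
    (fun S S' _ h i hi => by
      rw [Finset.mem_range] at hi
      exact hC.eq_of_lossless (by omega) fun j _ h2 => h j (Finset.mem_range.2 (by omega)))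
    (fun S S' _ h i hi => by
      rw [Finset.mem_range] at hi
      exact hC.eq_of_burst 0 (by omega) fun j _ h1 h2 => h j (Finset.mem_Ico.2 (by omega)))
    (fun S S' _ h h' i hi => by
      rw [Finset.mem_range] at hi
      refine hC.eq_of_lossless (by omega) fun j _ h2 => ?_
      by_cases hj : j < b
      · exact h j (Finset.mem_range.2 hj)
      · exact h' j (Finset.mem_Ico.2 (by omega)))
  rwa [Finset.sum_range_add_sum_Ico _ (by omega)] at h

end Feasible

end Code

/-! ### From numbers of sent symbols to rates -/

theorem Code.rate_le {F : Type u} {k : ℕ → ℕ} (C : Code F k) (t : ℕ) :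
    C.rate t ≤ ∑ i ∈ Finset.range (t + 1), (k i : ℝ) := by
  have hK : (0 : ℝ) ≤ ∑ i ∈ Finset.range (t + 1), (k i : ℝ) := by positivity
  rw [Code.rate, ← Nat.cast_sum (f := C.n)]
  rcases Nat.eq_zero_or_pos (∑ i ∈ Finset.range (t + 1), C.n i) with h | h
  · rw [h, Nat.cast_zero, div_zero]
    exact hK
  · exact div_le_self hK (by exact_mod_cast h)

/-- Numbers of sent symbols are integers, so a code which sends more symbols than some feasible
offline code misses the offline-optimal rate by a fixed amount. -/
theorem rate_le_offlineOptimalRate_sub {F : Type u} {τ b τL w t N : ℕ} {k : ℕ → ℕ}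
    (hN : 0 < N) (hk : 0 < ∑ i ∈ Finset.range (t + 1), k i)
    (hoff : ∃ C : Code F k, C.Feasible τ b τL w t ∧ ∑ i ∈ Finset.range (t + 1), C.n i = N)
    (C : Code F k) (hC : N < ∑ i ∈ Finset.range (t + 1), C.n i) :
    C.rate t ≤ offlineOptimalRate F τ b τL w t k - 1 / ((N : ℝ) + 1) ^ 2 := by
  obtain ⟨D, hD, hDN⟩ := hoff
  have hbdd : BddAbove {r : ℝ | ∃ C : Code F k, C.Feasible τ b τL w t ∧ C.rate t = r} := by
    refine ⟨∑ i ∈ Finset.range (t + 1), (k i : ℝ), ?_⟩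
    rintro _ ⟨C', _, rfl⟩
    exact C'.rate_le t
  have h1 : D.rate t ≤ offlineOptimalRate F τ b τL w t k := le_csSup hbdd ⟨D, hD, rfl⟩
  have h2 : D.rate t = (∑ i ∈ Finset.range (t + 1), (k i : ℝ)) / N := by
    rw [Code.rate, ← Nat.cast_sum (f := D.n), hDN]
  have hK : (1 : ℝ) ≤ ∑ i ∈ Finset.range (t + 1), (k i : ℝ) := by exact_mod_cast hk
  have h3 : C.rate t ≤ (∑ i ∈ Finset.range (t + 1), (k i : ℝ)) / (N + 1) := by
    rw [Code.rate, ← Nat.cast_sum (f := C.n)]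
    exact div_le_div_of_nonneg_left (by linarith) (by positivity) (by exact_mod_cast hC)
  generalize (∑ i ∈ Finset.range (t + 1), (k i : ℝ)) = K at *
  have hN' : (0 : ℝ) < N := by exact_mod_cast hN
  have h4 : 1 / ((N : ℝ) + 1) ^ 2 ≤ K / N - K / (N + 1) := by
    rw [div_sub_div _ _ hN'.ne' (by positivity), div_le_div_iff₀ (by positivity) (by positivity)]
    nlinarith
  linarith

/-- If `k₁` and `k₂` agree up to time slot `y`, and no two codes for them which agree in the packet
sizes up to time slot `y` send at most `N₁` and `N₂` symbols, then every online code falls short on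
one of the sequences. -/
theorem exists_rate_gap {τ b τL N₁ N₂ y t₁ : ℕ} {k₁ k₂ : ℕ → ℕ}
    (h₁ : Achievable τ b τL k₁ N₁) (h₂ : Achievable τ b τL k₂ N₂) (hN₁ : 0 < N₁) (hN₂ : 0 < N₂)
    (hk : ∀ j ≤ y, k₁ j = k₂ j) (hk₁ : 0 < k₁ 0)
    (hlow : ∀ t w : ℕ, t₁ ≤ t → ∀ (F : Type u) [Field F] [Fintype F]
      (C₁ : Code F k₁) (C₂ : Code F k₂), C₁.Feasible τ b τL w t → C₂.Feasible τ b τL w t →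
      (∀ j ≤ y, C₁.n j = C₂.n j) → ∑ i ∈ Finset.range (t + 1), C₁.n i ≤ N₁ →
      ∑ i ∈ Finset.range (t + 1), C₂.n i ≤ N₂ → False) :
    ∃ (k₁ k₂ : ℕ → ℕ) (t₀ m₀ : ℕ) (ε : ℝ), 0 < ε ∧
      ∀ t m : ℕ, t₀ ≤ t → m₀ ≤ m →
        IsSizeSeq τ m t k₁ ∧ IsSizeSeq τ m t k₂ ∧
        ∀ w : ℕ, τ < w → ∀ (F : Type u) [Field F] [Fintype F] (C : OnlineCode F),
          C.Feasible τ b τL w m t →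
            (C.toCode k₁).rate t ≤ offlineOptimalRate F τ b τL w t k₁ - ε ∨
            (C.toCode k₂).rate t ≤ offlineOptimalRate F τ b τL w t k₂ - ε := by
  obtain ⟨a₁, ha₁⟩ := h₁.exists_code
  obtain ⟨a₂, ha₂⟩ := h₂.exists_code
  obtain ⟨c₁, hc₁⟩ := h₁.exists_isSizeSeq
  obtain ⟨c₂, hc₂⟩ := h₂.exists_isSizeSeq
  refine ⟨k₁, k₂, a₁ + a₂ + c₁ + c₂ + t₁, N₁ + N₂,
    min (1 / ((N₁ : ℝ) + 1) ^ 2) (1 / ((N₂ : ℝ) + 1) ^ 2), by positivity, fun t m ht hm => ?_⟩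
  have hs₁ := hc₁ t (by omega) m (by omega)
  have hs₂ := hc₂ t (by omega) m (by omega)
  refine ⟨hs₁, hs₂, fun w hw F _ _ C hC => ?_⟩
  have hpos : ∀ k : ℕ → ℕ, 0 < k 0 → 0 < ∑ i ∈ Finset.range (t + 1), k i := fun k h0 =>
    h0.trans_le (Finset.single_le_sum (f := k) (fun _ _ => Nat.zero_le _)
      (Finset.mem_range.2 (Nat.succ_pos t)))
  have hn : ∀ j ≤ y, (C.toCode k₁).n j = (C.toCode k₂).n j := fun j hj =>
    congrArg (C.n j) (funext fun i => hk i (by omega))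
  rcases Nat.lt_or_ge N₁ (∑ i ∈ Finset.range (t + 1), (C.toCode k₁).n i) with h | h
  · exact Or.inl ((rate_le_offlineOptimalRate_sub hN₁ (hpos k₁ hk₁)
      (ha₁ t (by omega) w hw F) _ h).trans (sub_le_sub_left (min_le_left _ _) _))
  rcases Nat.lt_or_ge N₂ (∑ i ∈ Finset.range (t + 1), (C.toCode k₂).n i) with h' | h'
  · exact Or.inr ((rate_le_offlineOptimalRate_sub hN₂ (hpos k₂ (hk 0 (Nat.zero_le y) ▸ hk₁))
      (ha₂ t (by omega) w hw F) _ h').trans (sub_le_sub_left (min_le_right _ _) _))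
  · exact (hlow t w (by omega) F _ _ (hC _ hs₁) (hC _ hs₂) hn h h').elim

theorem sum_range_unitSize (a M : ℕ) :
    ∑ i ∈ Finset.range M, unitSize a i = if a < M then 1 else 0 := by
  simp [unitSize, Finset.sum_ite_eq]

theorem sum_range_sum_unitSize {ι : Type*} (I : Finset ι) (a : ι → ℕ) {M : ℕ}
    (h : ∀ x ∈ I, a x < M) :
    ∑ i ∈ Finset.range M, (∑ x ∈ I, unitSize (a x)) i = I.card := by
  simp only [Finset.sum_apply]
  rw [Finset.sum_comm, Finset.card_eq_sum_ones]
  exact Finset.sum_congr rfl fun x hx => by rw [sum_range_unitSize, if_pos (h x hx)]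

/-! ### The pairs of size sequences -/

/-- With lossless delay at least `b`, the message `S[0]` alone is best spread evenly over `p ≥ 2`
bursts, but has to be sent at once if the following time slots are to be filled evenly by the
linked chains: in the first case at most one symbol is sent in time slot `0`, in the second at
least `p`. -/
theorem exists_pair_of_two_le {τ b p r s : ℕ} (hb : 1 ≤ b) (hp : 2 ≤ p) (hr : r < b)
    (hrs : r ≤ s) (hs : 1 ≤ s) (hτ : τ = p * b + s) :
    ∃ (k₁ k₂ : ℕ → ℕ) (N₁ N₂ : ℕ), Achievable τ b ((p - 1) * b + r) k₁ N₁ ∧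
      Achievable τ b ((p - 1) * b + r) k₂ N₂ ∧ 0 < N₁ ∧ 0 < N₂ ∧ k₁ 0 = k₂ 0 ∧ 0 < k₁ 0 ∧
      ∀ t w : ℕ, τ + b ≤ t → ∀ (F : Type u) [Field F] [Fintype F]
      (C₁ : Code F k₁) (C₂ : Code F k₂), C₁.Feasible τ b ((p - 1) * b + r) w t →
      C₂.Feasible τ b ((p - 1) * b + r) w t → C₁.n 0 = C₂.n 0 →
      ∑ i ∈ Finset.range (t + 1), C₁.n i ≤ N₁ → ∑ i ∈ Finset.range (t + 1), C₂.n i ≤ N₂ →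
      False := by
  obtain ⟨p, rfl⟩ : ∃ p', p = p' + 1 := ⟨p - 1, by omega⟩
  have hpb : (p + 1) * b = p * b + b := by ring
  have hbpb : b ≤ p * b := Nat.le_mul_of_pos_left b (by omega)
  rw [Nat.add_sub_cancel]
  -- All chains start at or before `b - r`, so that everything is due by time slot `p * b` if
  -- nothing is lost.
  obtain ⟨h, hh⟩ : ∃ h, h = b - max r 1 := ⟨_, rfl⟩
  have hhb : h < b ∧ h + r ≤ b ∧ b ≤ h + s := by omega
  have hlb : ∀ l < p + 1, l * b ≤ p * b := fun l hl => Nat.mul_le_mul_right b (by omega)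
  have h₁ : Achievable τ b (p * b + r) (∑ l ∈ Finset.range (p + 1), unitSize 0) (p + 1 + 1) :=
    Achievable.chain hb (p + 1) 0 ((p + 1) * b) (fun _ => 0) (by omega) (by omega) fun l hl => by
      have := hlb l hl
      omega
  have h₂ := (Achievable.linkedChains (τL := p * b + r) hb (p + 1) s (by omega) hτ
    (Finset.range (h + 1)) (fun x hx => by rw [Finset.mem_range] at hx; omega)
    (fun x hx hx0 => ⟨x - 1, by rw [Finset.mem_range] at *; omega, by omega, by omega⟩)
    h (by simp) hhb.2.2 (fun x l => if l = 0 then x else b - r) (b - r)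
    (fun x hx l hl => by
      rw [Finset.mem_range] at hx
      have := hlb l hl
      split_ifs with hl0
      · subst hl0
        omega
      · have := Nat.le_mul_of_pos_left b (Nat.pos_of_ne_zero hl0)
        omega)
    (fun x hx => by rw [Finset.mem_range] at hx; omega) (by omega) (by omega)).nsmul (p + 1)
  have hchain0 : ∀ x, (∑ l ∈ Finset.range (p + 1),
      unitSize (if l = 0 then x else b - r)) 0 = if x = 0 then 1 else 0 := by
    intro x
    have hbr : b - r ≠ 0 := by omega
    rw [Finset.sum_apply, Finset.sum_range_succ', Finset.sum_eq_zero]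
    · simp [unitSize]
    · intro l _
      simp [unitSize, hbr]
  have hK₂ : ∑ i ∈ Finset.range (b - r + 1), ((p + 1) •
      (∑ x ∈ Finset.range (h + 1), ∑ l ∈ Finset.range (p + 1),
        unitSize (if l = 0 then x else b - r) + unitSize (b - r))) i =
      (p + 1) * ((h + 1) * (p + 1) + 1) := by
    simp only [Pi.smul_apply, Pi.add_apply, smul_eq_mul]
    rw [← Finset.mul_sum, Finset.sum_add_distrib, sum_range_unitSize, if_pos (by omega),
      ← Finset.sum_product', sum_range_sum_unitSize, Finset.card_product, Finset.card_range,
      Finset.card_range]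
    rintro ⟨x, l⟩ hx
    rw [Finset.mem_product, Finset.mem_range] at hx
    change (if l = 0 then x else b - r) < _
    split_ifs <;> omega
  refine ⟨_, _, _, _, h₁, h₂, by omega, by positivity, ?_, ?_, ?_⟩
  · have hbr : b - r ≠ 0 := by omega
    rw [Pi.smul_apply, Pi.add_apply, Finset.sum_apply, Finset.sum_apply,
      Finset.sum_congr rfl fun x _ => hchain0 x]
    simp [unitSize, hbr]
  · simp [unitSize]
  · intro t w ht F _ _ C₁ C₂ hC₁ hC₂ hn hN₁ hN₂
    rw [Finset.card_range] at hN₂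
    have h0 := hC₁.sum_add_sum_Ico_le (s := 0) (M := 1) (by omega) (by omega)
    rw [sum_range_sum_unitSize _ _ (fun _ _ => one_pos), Finset.card_range] at h0
    have h0' := Finset.single_le_sum (f := C₁.n) (fun _ _ => Nat.zero_le _)
      (Finset.mem_Ico.2 ⟨le_rfl, (by omega : 0 < 0 + b)⟩)
    have hall := hC₂.sum_le_sum_range (M := b - r + 1) (T := (p + 1) * b) (by omega) (by omega)
    rw [hK₂] at hall
    -- The time slots `1, …, p * b` are covered by `p` possible bursts.
    have hwin : ∀ l ≤ p + 1, ∑ j ∈ Finset.range (l * b + 1), C₂.n j ≤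
        C₂.n 0 + l * ((p + 1) * (h + 1)) := by
      intro l
      induction l with
      | zero => simp
      | succ l ih =>
        intro hl
        have hl' := hlb l (by omega)
        have hcut := hC₂.sum_add_sum_Ico_le (s := l * b + 1) (M := b - r + 1) (by omega) (by omega)
        rw [hK₂] at hcut
        have hsplit := Finset.sum_range_add_sum_Ico C₂.n
          (show l * b + 1 ≤ l * b + 1 + b by omega)
        have h1 : (l + 1) * b + 1 = l * b + 1 + b := by ring
        rw [h1, ← hsplit]
        have := ih (by omega)
        nlinarith
    have := hwin (p + 1) le_rfl
    nlinarith

/-- For `τL < b` and `2 * b ≤ τ`: the second of two unit messages should be delayed beyond the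
burst that contains the first, unless the messages that follow fill that place. With `c = b - r` the
first case allows one symbol up to time slot `c`, the second one requires two. -/
theorem exists_pair_of_two_mul_le {τ b r : ℕ} (hr : r < b) (hr1 : 1 ≤ r) (hτ : 2 * b ≤ τ) :
    ∃ (k₁ k₂ : ℕ → ℕ) (N₁ N₂ : ℕ), Achievable τ b r k₁ N₁ ∧ Achievable τ b r k₂ N₂ ∧
      0 < N₁ ∧ 0 < N₂ ∧ (∀ j ≤ b - r, k₁ j = k₂ j) ∧ 0 < k₁ 0 ∧
      ∀ t w : ℕ, τ + b ≤ t → ∀ (F : Type u) [Field F] [Fintype F]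
      (C₁ : Code F k₁) (C₂ : Code F k₂), C₁.Feasible τ b r w t → C₂.Feasible τ b r w t →
      (∀ j ≤ b - r, C₁.n j = C₂.n j) →
      ∑ i ∈ Finset.range (t + 1), C₁.n i ≤ N₁ → ∑ i ∈ Finset.range (t + 1), C₂.n i ≤ N₂ →
      False := by
  obtain ⟨c, hc⟩ : ∃ c, c = b - r := ⟨_, rfl⟩
  rw [← hc]
  have hchain : ∀ x a a', x ≤ a → a ≤ x → x ≤ a' → a' ≤ x + b → x + b ≤ a' + r →
      Achievable τ b r (unitSize a + unitSize a') 3 := by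
    intro x a a' h1 h2 h3 h4 h5
    have := Achievable.chain (τ := τ) (b := b) (τL := r) (by omega) 2 x (x + 2 * b)
      (fun i => if i = 0 then a else a') le_rfl (by omega) fun i hi => by
        obtain rfl | rfl : i = 0 ∨ i = 1 := by omega
        · simpa using ⟨h1, h2, by omega⟩
        · simpa using ⟨h3, h4, h5⟩
    simpa [Finset.sum_range_succ] using this
  refine ⟨_, _, _, _, hchain 0 0 c ?_ ?_ ?_ ?_ ?_, (hchain 0 0 (c + 1) ?_ ?_ ?_ ?_ ?_).add
    (hchain c c (2 * c) ?_ ?_ ?_ ?_ ?_), by omega, by omega, ?_, ?_, ?_⟩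
  any_goals omega
  · intro j hj
    simp only [Pi.add_apply, unitSize]
    split_ifs <;> omega
  · simp [unitSize]
  · intro t w ht F _ _ C₁ C₂ hC₁ hC₂ hn hN₁ hN₂
    have h1 := hC₁.sum_add_sum_Ico_le (s := 0) (M := c + 1) (by omega) (by omega)
    have h2 := hC₂.sum_le_sum_range (M := 2 * c + 1) (T := b + c) (by omega) (by omega)
    have h3 := hC₂.sum_add_sum_Ico_le (s := c + 1) (M := 2 * c + 1) (by omega) (by omega)
    simp only [Pi.add_apply, Finset.sum_add_distrib, sum_range_unitSize] at h1 h2 h3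
    rw [if_pos (by omega), if_pos (by omega)] at h1
    rw [if_pos (by omega), if_pos (by omega), if_pos (by omega), if_pos (by omega)] at h2 h3
    have h4 := Finset.sum_range_add_sum_Ico C₂.n (show c + 1 ≤ c + 1 + b by omega)
    rw [show c + 1 + b = b + c + 1 by omega] at h3 h4
    have h5 : ∑ j ∈ Finset.range (c + 1), C₁.n j = ∑ j ∈ Finset.range (c + 1), C₂.n j :=
      Finset.sum_congr rfl fun j hj => hn j (Nat.lt_succ_iff.1 (Finset.mem_range.1 hj))
    have h6 := Finset.sum_le_sum_of_subset (f := C₁.n)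
      (show Finset.range (c + 1) ⊆ Finset.Ico 0 (0 + b) from fun j hj => by
        rw [Finset.mem_range] at hj
        exact Finset.mem_Ico.2 (by omega))
    omega

/-- For `τL < b` and `τ < 2 * b`: the last of the messages that head the chains should partly be
delayed beyond the burst that contains them all, unless a message in time slot `b` is the common
symbol of the linked chains. The chains start in the time slots `0, …, z` and `b - r`, and up to
time slot `z + s` the first case allows `2 * z + 3` symbols, the second one requires
`2 * z + 4`. -/
theorem exists_pair_of_lt_two_mul {τ b r s : ℕ} (hr1 : 1 ≤ r) (hrs : r ≤ s) (hsb : s < b)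
    (hτ : τ = b + s) :
    ∃ (k₁ k₂ : ℕ → ℕ) (N₁ N₂ : ℕ), Achievable τ b r k₁ N₁ ∧ Achievable τ b r k₂ N₂ ∧
      0 < N₁ ∧ 0 < N₂ ∧ (∀ j ≤ b - 1, k₁ j = k₂ j) ∧ 0 < k₁ 0 ∧
      ∀ t w : ℕ, τ + b ≤ t → ∀ (F : Type u) [Field F] [Fintype F]
      (C₁ : Code F k₁) (C₂ : Code F k₂), C₁.Feasible τ b r w t → C₂.Feasible τ b r w t →
      (∀ j ≤ b - 1, C₁.n j = C₂.n j) →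
      ∑ i ∈ Finset.range (t + 1), C₁.n i ≤ N₁ → ∑ i ∈ Finset.range (t + 1), C₂.n i ≤ N₂ →
      False := by
  obtain ⟨z, hz⟩ : ∃ z, z = b - r - s := ⟨_, rfl⟩
  have hnot : b - r ∉ Finset.range (z + 1) := by rw [Finset.mem_range]; omega
  have hlinked : ∀ d, b - r ≤ d → d ≤ b → b ≤ d + r → Achievable τ b r
      (unitSize (b - r) + ∑ x ∈ Finset.range (z + 1), unitSize x + unitSize d)
      (2 * z + 5) := by
    intro d hd hdb hdr
    have h := Achievable.linkedChains (τL := r) (τ := τ) (b := b) (by omega) 1 s le_rfl (by omega)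
      (insert (b - r) (Finset.range (z + 1)))
      (fun x hx => by rw [Finset.mem_insert, Finset.mem_range] at hx; omega)
      (fun x hx hx0 => by
        rw [Finset.mem_insert, Finset.mem_range] at hx
        obtain rfl | hx := hx
        · exact ⟨z, by simp, by omega, by omega⟩
        · exact ⟨x - 1, by rw [Finset.mem_insert, Finset.mem_range]; omega, by omega, by omega⟩)
      (b - r) (Finset.mem_insert_self _ _) (by omega) (fun x _ => x) d
      (fun x hx l hl => by
        obtain rfl : l = 0 := by omega
        omega)
      (fun x hx => by rw [Finset.mem_insert, Finset.mem_range] at hx; omega) (by omega) (by omega)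
    rw [Finset.sum_insert hnot, Finset.card_insert_of_notMem hnot, Finset.card_range] at h
    simp only [Finset.sum_range_one] at h
    convert h using 1
    ring
  -- On the first sequence half of each message is protected by linked chains, whose common symbol
  -- is the other half of the message in slot `b - r`; the other halves in the slots `0, …, z` are
  -- repeated.
  have hrep : Achievable τ b r (∑ x ∈ Finset.range (z + 1), unitSize x)
      (∑ x ∈ Finset.range (z + 1), 2) :=
    Achievable.sum _ fun x hx => by
      have h := Achievable.chain (τ := τ) (b := b) (τL := r) (by omega) 1 x (x + τ) (fun _ => x)
        (by omega) le_rfl fun i hi => by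
          obtain rfl : i = 0 := by omega
          omega
      simpa using h
  refine ⟨_, _, _, _, (hlinked (b - r) le_rfl (by omega) (by omega)).add hrep,
    (hlinked b (by omega) le_rfl (by omega)).nsmul 2, by omega, by omega, ?_, ?_, ?_⟩
  · intro j hj
    have hbj : unitSize b j = 0 := if_neg (by omega)
    simp only [Pi.add_apply, Pi.smul_apply, smul_eq_mul, hbj]
    ring
  · rw [Pi.add_apply, Finset.sum_apply]
    refine Nat.add_pos_right _ (Finset.sum_pos' (fun _ _ => Nat.zero_le _) ⟨0, by simp, ?_⟩)
    simp [unitSize]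
  · intro t w ht F _ _ C₁ C₂ hC₁ hC₂ hn hN₁ hN₂
    have h1 := hC₁.sum_add_sum_Ico_le (s := 0) (M := b) (by omega) (by omega)
    have h2 := hC₂.sum_add_sum_le_sum_range (z := z) (M := b + 1) (by omega) (by omega) (by omega)
      (by omega) (by omega)
    have h3 := hC₂.sum_add_sum_Ico_le (s := z + s + 1) (M := b + 1) (by omega) (by omega)
    have hG : ∀ M, z < M → ∑ i ∈ Finset.range M, (∑ x ∈ Finset.range (z + 1), unitSize x) i =
        z + 1 := fun M hM => by
      rw [sum_range_sum_unitSize _ _ fun x hx => by rw [Finset.mem_range] at hx; omega,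
        Finset.card_range]
    simp only [Pi.add_apply, Pi.smul_apply, smul_eq_mul, Finset.sum_add_distrib,
      ← Finset.mul_sum, sum_range_unitSize] at h1 h2 h3
    rw [hG _ (by omega), if_pos (by omega)] at h1
    rw [hG _ (by omega), hG _ (by omega), if_pos (by omega), if_pos (by omega)] at h2
    rw [hG _ (by omega), if_pos (by omega), if_pos (by omega)] at h3
    rw [Finset.sum_const, Finset.card_range, smul_eq_mul] at hN₁
    have h4 := Finset.sum_range_add_sum_Ico C₂.n (show z + s + 1 ≤ z + s + 1 + b by omega)
    rw [show z + s + 1 + b = z + τ + 1 by omega] at h3 h4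
    have h5 : ∑ j ∈ Finset.range (z + s + 1), C₁.n j = ∑ j ∈ Finset.range (z + s + 1), C₂.n j :=
      Finset.sum_congr rfl fun j hj => hn j (by rw [Finset.mem_range] at hj; omega)
    have h6 := Finset.sum_le_sum_of_subset (f := C₁.n)
      (show Finset.range (z + s + 1) ⊆ Finset.Ico 0 (0 + b) from fun j hj => by
        rw [Finset.mem_range] at hj
        exact Finset.mem_Ico.2 (by omega))
    omega

end Streaming

theorem mainTheorem2 (τ b τL : ℕ) (hb : 1 ≤ b) (hbτ : b ≤ τ) (hτL : τL ≤ τ - b)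
    (hRegime1 : ¬ (τL = τ - b ∧ b ∣ τ)) (hRegime2 : ¬ τL = 0) :
    ∃ (k₁ k₂ : ℕ → ℕ) (t₀ m₀ : ℕ) (ε : ℝ), 0 < ε ∧
      ∀ t m : ℕ, t₀ ≤ t → m₀ ≤ m →
        Streaming.IsSizeSeq τ m t k₁ ∧ Streaming.IsSizeSeq τ m t k₂ ∧
        ∀ w : ℕ, τ < w → ∀ (F : Type u) [Field F] [Fintype F] (C : Streaming.OnlineCode F),
          C.Feasible τ b τL w m t →
            (C.toCode k₁).rate t ≤ Streaming.offlineOptimalRate F τ b τL w t k₁ - ε ∨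
            (C.toCode k₂).rate t ≤ Streaming.offlineOptimalRate F τ b τL w t k₂ - ε := by
  obtain ⟨q, hq⟩ : ∃ q, q = τL / b := ⟨_, rfl⟩
  obtain ⟨r, hr⟩ : ∃ r, r = τL % b := ⟨_, rfl⟩
  have hrb : r < b := hr ▸ Nat.mod_lt _ hb
  have hdiv : τL = q * b + r := by
    rw [hq, hr, mul_comm]
    exact (Nat.div_add_mod _ _).symm
  have hqb : (q + 1) * b = q * b + b := by ring
  obtain ⟨s, hs⟩ : ∃ s, τ = (q + 1) * b + s := ⟨τ - (q + 1) * b, by omega⟩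
  have hs1 : 1 ≤ s := by
    by_contra hs0
    obtain rfl : s = 0 := by omega
    exact hRegime1 ⟨by omega, Dvd.intro_left (q + 1) (by omega)⟩
  rcases Nat.eq_zero_or_pos q with rfl | hq0
  · rw [zero_mul, zero_add] at hdiv
    rw [zero_add, one_mul] at hs
    subst hdiv
    rcases Nat.lt_or_ge s b with hsb | hsb
    · obtain ⟨k₁, k₂, N₁, N₂, h₁, h₂, hN₁, hN₂, hk, hk₁, hlow⟩ :=
        Streaming.exists_pair_of_lt_two_mul.{u} (τ := τ) (b := b) (r := τL) (s := s) (by omega)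
          (by omega) hsb hs
      exact Streaming.exists_rate_gap h₁ h₂ hN₁ hN₂ hk hk₁ hlow
    · obtain ⟨k₁, k₂, N₁, N₂, h₁, h₂, hN₁, hN₂, hk, hk₁, hlow⟩ :=
        Streaming.exists_pair_of_two_mul_le.{u} (τ := τ) (b := b) (r := τL) (by omega)
          (by omega) (by omega)
      exact Streaming.exists_rate_gap h₁ h₂ hN₁ hN₂ hk hk₁ hlow
  · obtain ⟨k₁, k₂, N₁, N₂, h₁, h₂, hN₁, hN₂, hk, hk₁, hlow⟩ :=
      Streaming.exists_pair_of_two_le.{u} (τ := τ) (p := q + 1) (s := s) hb (by omega) hrb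
        (by omega) hs1 hs
    rw [Nat.add_sub_cancel, ← hdiv] at h₁ h₂ hlow
    refine Streaming.exists_rate_gap (y := 0) h₁ h₂ hN₁ hN₂ (fun j hj => ?_) hk₁
      fun t w ht F _ _ C₁ C₂ hC₁ hC₂ hn => hlow t w ht F C₁ C₂ hC₁ hC₂ (hn 0 le_rfl)
    obtain rfl : j = 0 := by omega
    exact hk
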